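/- Let $d\ge 1$ be an integer and let $V:\mathbb R^d\to\mathbb R$ be of class $C^2$. For $c\in\mathbb R$ consider $$\ddot u=-c\,\dot u+\nabla V(u)\qquad(1)$$ and the equivalent first order system $\dot U=F_{c,V}(U)$ in $\mathbb R^{2d}$, where $U=(u,v)$ and $F_{c,V}(u,v)=(v,\nabla V(u)-cv)$. A critical point $e$ of $V$ is *non-degenerate* if $0$ is not in the spectrum of $D^2V(e)$; write $E=(e,0)$ for the corresponding equilibrium. Let $E^s_{c,V}(E)$ (resp. $E^u_{c,V}(E)$) be the stable (resp. unstable) subspace of $DF_{c,V}(E)$, that is, the real subspace of $\mathbb R^{2d}$ associated with the generalized eigenspaces for the eigenvalues with negative (resp. positive) real part. The *stable manifold* $W^s_{c,V}(E)$ (resp. *unstable manifold* $W^u_{c,V}(E)$) is the union of the images of the solutions $\xi\mapsto U(\xi)$ of $\dot U=F_{c,V}(U)$, defined on a neighbourhood of $+\infty$ (resp. $-\infty$), that converge to $E$ as $\xi\to+\infty$ (resp. $\xi\to-\infty$) * at an exponential rate: for some $\beta>0$, $|U(\xi)-E|=O(e^{-\beta|\xi|})$, and * tangentially to $E^s_{c,V}(E)$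 (resp. $E^u_{c,V}(E)$): the distance from $U(\xi)-E$ to this subspace is $o(|U(\xi)-E|)$. Let $e_-$ and $e_+$ be critical points of $V$. The *profile of a front or pulse connecting $e_-$ to $e_+$ at speed $c$* is a non-constant solution $u:\mathbb R\to\mathbb R^d$ of (1) such that $u(\xi)\to e_-$ as $\xi\to-\infty$ and $u(\xi)\to e_+$ as $\xi\to+\infty$, where $e_-\ne e_+$ if $c\neq0$ (travelling front), while if $c=0$ the points $e_-$ and $e_+$ may be distinct (standing front) or equal (standing pulse). **Proposition.** Let $e_-$ and $e_+$ be two (possibly equal) non-degenerate critical points of $V$, let $E_\pm=(e_\pm,0)$, and let $c$ be a real number (zero or not). For every profile $u$ of a front or pulse connecting $e_-$ to $e_+$ at speed $c$, the image of $\xi\mapsto(u(\xi),\dot u(\xi))$ is contained in $W^u_{c,V}(E_-)\cap W^s_{c,V}(E_+)$. In particular $\dot u(\xi)\to0$ as $\xi\to\pm\infty$, and $(u,\dot u)$ itself converges to $E_-$ as $\xi\to-\infty$ at an exponential rate and tangentially to $E^u_{c,V}(E_-)$, and to $E_+$ as $\xi\to+\infty$ at an exponential rate and tangentially to $E^s_{c,V}(E_+)$,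 in the sense of the two conditions above. -/

import Mathlib

open Set Filter Topology Asymptotics
open scoped Gradient TensorProduct

/-- The space `ℝ^d` with its Euclidean norm. -/
abbrev Rd (d : ℕ) : Type := EuclideanSpace ℝ (Fin d)

/-- `e` is a non-degenerate critical point of `V`: the gradient of `V` vanishes at `e`, and `0` is
not in the spectrum of the Hessian `D²V(e)` (the derivative of the gradient at `e`). -/
structure IsNondegenerateCriticalPoint {d : ℕ} (V : Rd d → ℝ) (e : Rd d) : Prop where
  gradient_eq_zero : ∇ V e = 0
  zero_notMem_spectrum : (0 : ℝ) ∉ spectrum ℝ (fderiv ℝ (∇ V) e)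

/-- `u` is a global solution of the second order system `ü = -c u̇ + ∇V(u)`. -/
def IsWaveProfile {d : ℕ} (c : ℝ) (V : Rd d → ℝ) (u : ℝ → Rd d) : Prop :=
  Differentiable ℝ u ∧
    ∀ ξ : ℝ, HasDerivAt (deriv u) (-(c • deriv u ξ) + ∇ V (u ξ)) ξ

/-- `u` is a non-constant global solution of `ü = -c u̇ + ∇V(u)` that tends to `em` at `-∞` and to
`ep` at `+∞`. -/
structure ConnectsProfile {d : ℕ} (c : ℝ) (V : Rd d → ℝ) (em ep : Rd d) (u : ℝ → Rd d) :
    Prop where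
  isWaveProfile : IsWaveProfile c V u
  nonconstant : ¬ ∃ a : Rd d, ∀ ξ : ℝ, u ξ = a
  tendsto_atBot : Tendsto u atBot (𝓝 em)
  tendsto_atTop : Tendsto u atTop (𝓝 ep)

/-- `u` is the profile of a front travelling at the speed `c` and connecting `em` to `ep`. -/
def IsTravellingFront {d : ℕ} (c : ℝ) (V : Rd d → ℝ) (em ep : Rd d) (u : ℝ → Rd d) : Prop :=
  ConnectsProfile c V em ep u ∧ c ≠ 0 ∧ em ≠ ep

/-- `u` is the profile of a standing front connecting `em` to `ep`. -/
def IsStandingFront {d : ℕ} (c : ℝ) (V : Rd d → ℝ) (em ep : Rd d) (u : ℝ → Rd d) : Prop :=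
  ConnectsProfile c V em ep u ∧ c = 0 ∧ em ≠ ep

/-- `u` is the profile of a standing pulse connecting `em = ep` to itself. -/
def IsStandingPulse {d : ℕ} (c : ℝ) (V : Rd d → ℝ) (em ep : Rd d) (u : ℝ → Rd d) : Prop :=
  ConnectsProfile c V em ep u ∧ c = 0 ∧ em = ep

/-- `u` is the profile of a front or pulse connecting `em` to `ep` and travelling at the speed `c`
(standing if `c = 0`). -/
def IsFrontOrPulse {d : ℕ} (c : ℝ) (V : Rd d → ℝ) (em ep : Rd d) (u : ℝ → Rd d) : Prop :=
  IsTravellingFront c V em ep u ∨ IsStandingFront c V em ep u ∨ IsStandingPulse c V em ep u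

/-- The vector field `F_{c,V}(u, v) = (v, ∇V(u) - c v)` on `ℝ^{2d} = ℝ^d × ℝ^d`. -/
noncomputable def vectorField {d : ℕ} (c : ℝ) (V : Rd d → ℝ) (U : Rd d × Rd d) : Rd d × Rd d :=
  (U.2, ∇ V U.1 - c • U.2)

/-- The spectral subspace of a linear endomorphism `A` of a real vector space associated with a set
`Λ` of complex numbers: the vectors `x` which, in the complexification, belong to the sum of the
generalized eigenspaces of `A` for the eigenvalues in `Λ`. -/
noncomputable def spectralSubspace {F : Type*} [AddCommGroup F] [Module ℝ F] (A : F →ₗ[ℝ] F)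
    (Λ : Set ℂ) : Submodule ℝ F :=
  ((⨆ l ∈ Λ, Module.End.maxGenEigenspace (A.baseChange ℂ) l).restrictScalars ℝ).comap
    (TensorProduct.mk ℝ ℂ F 1)

/-- The stable subspace at `E` of the linearization `DF_{c,V}(E)` (eigenvalues with negative real
part). -/
noncomputable def stableSubspace {d : ℕ} (c : ℝ) (V : Rd d → ℝ) (E : Rd d × Rd d) :
    Submodule ℝ (Rd d × Rd d) :=
  spectralSubspace (fderiv ℝ (vectorField c V) E).toLinearMap {l : ℂ | l.re < 0}

/-- The unstable subspace at `E` of the linearization `DF_{c,V}(E)` (eigenvalues with positive real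
part). -/
noncomputable def unstableSubspace {d : ℕ} (c : ℝ) (V : Rd d → ℝ) (E : Rd d × Rd d) :
    Submodule ℝ (Rd d × Rd d) :=
  spectralSubspace (fderiv ℝ (vectorField c V) E).toLinearMap {l : ℂ | 0 < l.re}

/-- As `ξ → +∞`, `U(ξ)` converges to `E` at an exponential rate, tangentially to the stable
subspace at `E`: the distance of `U(ξ) - E` to this subspace is negligible compared to
`‖U(ξ) - E‖`. -/
def ConvergesThroughStable {d : ℕ} (c : ℝ) (V : Rd d → ℝ) (E : Rd d × Rd d)
    (U : ℝ → Rd d × Rd d) : Prop :=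
  (∃ β : ℝ, 0 < β ∧ (fun ξ => U ξ - E) =O[atTop] (fun ξ => Real.exp (-(β * ξ)))) ∧
    (fun ξ => Metric.infDist (U ξ - E) (stableSubspace c V E : Set (Rd d × Rd d)))
      =o[atTop] (fun ξ => U ξ - E)

/-- As `ξ → -∞`, `U(ξ)` converges to `E` at an exponential rate, tangentially to the unstable
subspace at `E`. -/
def ConvergesThroughUnstable {d : ℕ} (c : ℝ) (V : Rd d → ℝ) (E : Rd d × Rd d)
    (U : ℝ → Rd d × Rd d) : Prop :=
  (∃ β : ℝ, 0 < β ∧ (fun ξ => U ξ - E) =O[atBot] (fun ξ => Real.exp (β * ξ))) ∧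
    (fun ξ => Metric.infDist (U ξ - E) (unstableSubspace c V E : Set (Rd d × Rd d)))
      =o[atBot] (fun ξ => U ξ - E)

/-- The (global) stable manifold of `E` for `U̇ = F_{c,V}(U)`: the union of the images of the
solutions that converge to `E` at an exponential rate as `ξ → +∞`, tangentially to the stable
subspace. Solutions need not be global in the past: they are defined on some `(a, +∞)`. -/
def stableManifold {d : ℕ} (c : ℝ) (V : Rd d → ℝ) (E : Rd d × Rd d) : Set (Rd d × Rd d) :=
  {P | ∃ (U : ℝ → Rd d × Rd d) (a : ℝ),
    (∀ ξ ∈ Ioi a, HasDerivAt U (vectorField c V (U ξ)) ξ) ∧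
      ConvergesThroughStable c V E U ∧ P ∈ U '' Ioi a}

/-- The (global) unstable manifold of `E` for `U̇ = F_{c,V}(U)`: the union of the images of the
solutions (defined on some `(-∞, a)`) that converge to `E` at an exponential rate as `ξ → -∞`,
tangentially to the unstable subspace. -/
def unstableManifold {d : ℕ} (c : ℝ) (V : Rd d → ℝ) (E : Rd d × Rd d) : Set (Rd d × Rd d) :=
  {P | ∃ (U : ℝ → Rd d × Rd d) (a : ℝ),
    (∀ ξ ∈ Iio a, HasDerivAt U (vectorField c V (U ξ)) ξ) ∧
      ConvergesThroughUnstable c V E U ∧ P ∈ U '' Iio a}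

/-!
Write `H = D²V(e)`. It is symmetric, so in an orthonormal eigenbasis `b i`, with eigenvalues `μ i`,
the coordinates `x i = ⟪b i, u - e⟫` and `y i = ⟪b i, u'⟫` of a solution solve the scalar equations
`x' = y`, `y' = μ x - c y + g`, where `g` is negligible compared to the norm of `(u - e, u')`. Since
`u → e`, also `u' → 0` (`tendsto_velocity_zero`), so that the solution is eventually small.

Each scalar equation is a saddle if `0 < μ`, and it is a sink, a source or a centre if `μ < 0` and
`c` is positive, negative or zero. Accordingly `(x, y)` is measured by three nonnegative quadratic
forms: `unstableForm` grows exponentially and `stableForm` decays exponentially, both up to the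
perturbation `g`, while `centerForm` is only present for `c = 0`. In that case the energy
`‖u'‖² / 2 - V(u)` is conserved and equal to its limit (`norm_velocity_sq_eq`); its Taylor expansion
at `e` bounds the centre part by the saddle part. If `P` and `S` are the sums of the unstable and
stable forms, the solution is thus bounded by `P + S`. As `P → 0`, a cone argument
(`eventually_le_of_expanding_contracting`) gives `P = o(S)` and the exponential decay of `S`; the
energy then shows that the centre part is `o(S)` too (`decay_of_coordinates`). Hence the solution
decays exponentially, and its distance to the span of the stable directions is negligible
(`decay_of_tendsto`).

Only one inclusion is needed about the spectral subspaces, namely that they contain the explicit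
stable directions. For a saddle they are eigenvectors of the linearization; for a sink, `(b, 0)` and
`(0, b)` are killed by `A² + c A - μ`, which has only complex roots with negative real part. The
behaviour at `-∞` follows by reversing the time, which replaces `c` by `-c` and reflects the
velocity.
-/

/-! ### A scalar dichotomy -/

theorem HasDerivAt.comp_neg_at {F : Type*} [NormedAddCommGroup F] [NormedSpace ℝ F] {f : ℝ → F}
    {f' : F} {t : ℝ} (h : HasDerivAt f f' t) : HasDerivAt (fun τ => f (-τ)) (-f') (-t) := by
  rw [← neg_neg t] at h
  simpa [Function.comp_def] using h.scomp (-t) (hasDerivAt_neg (-t))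

theorem monotoneOn_exp_mul_of_le_deriv {f : ℝ → ℝ} {a T : ℝ} (hf : Differentiable ℝ f)
    (h : ∀ t, T ≤ t → a * f t ≤ deriv f t) :
    MonotoneOn (fun t => Real.exp (-(a * t)) * f t) (Ici T) := by
  have hd : ∀ t, HasDerivAt (fun t => Real.exp (-(a * t)) * f t)
      (Real.exp (-(a * t)) * (-(a * 1)) * f t + Real.exp (-(a * t)) * deriv f t) t := fun t =>
    (((hasDerivAt_id t).const_mul a).neg.exp).mul (hf t).hasDerivAt
  refine monotoneOn_of_deriv_nonneg (convex_Ici T)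
    (fun t _ => (hd t).continuousAt.continuousWithinAt)
    (fun t _ => (hd t).differentiableAt.differentiableWithinAt) fun t ht => ?_
  rw [interior_Ici] at ht
  rw [(hd t).deriv]
  nlinarith [mul_nonneg (Real.exp_pos (-(a * t))).le (sub_nonneg.2 (h t ht.le))]

/-- If `P` expands and `S` contracts up to errors that are negligible compared to `P + S`, and if
`P` tends to `0`, then `P` is negligible compared to `S`, and `S` decays exponentially. -/
theorem eventually_le_of_expanding_contracting {P S N : ℝ → ℝ} {k C : ℝ} (hk : 0 < k)
    (hC : 0 < C) (hPd : Differentiable ℝ P) (hSd : Differentiable ℝ S)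
    (hP0 : ∀ t, 0 ≤ P t) (hS0 : ∀ t, 0 ≤ S t)
    (hN : ∀ᶠ t in atTop, N t ≤ C * (P t + S t))
    (hP : ∀ ε > 0, ∀ᶠ t in atTop, k * P t - ε * N t ≤ deriv P t)
    (hS : ∀ ε > 0, ∀ᶠ t in atTop, deriv S t ≤ -(k * S t) + ε * N t)
    (hlim : Tendsto P atTop (𝓝 0)) :
    (∀ δ > 0, ∀ᶠ t in atTop, P t ≤ δ * S t) ∧
      ∃ K, ∀ᶠ t in atTop, S t ≤ K * Real.exp (-(k / 2 * t)) := by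
  have key : ∀ δ > 0, ∀ᶠ t in atTop, P t ≤ δ * S t := by
    intro δ hδ
    -- `m` is the constant for which `m * (P + S) ≤ P + δ * S`; `ε` keeps the error below half of
    -- the growth of `P - δ * S`.
    set m := min 1 δ
    have hm : 0 < m := lt_min one_pos hδ
    obtain ⟨ε, hε, hεC⟩ : ∃ ε > 0, ε * C * (1 + δ) = k / 2 * m :=
      ⟨k / 2 * m / (C * (1 + δ)), by positivity, by field_simp⟩
    obtain ⟨T, hT⟩ := eventually_atTop.1 ((hN.and (hP ε hε)).and (hS ε hε))
    have hmono := monotoneOn_exp_mul_of_le_deriv (f := fun t => P t - δ * S t) (a := k / 2)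
      (T := T) (hPd.sub (hSd.const_mul δ)) fun t ht => by
        obtain ⟨⟨h1, h2⟩, h3⟩ := hT t ht
        have hd : deriv (fun t => P t - δ * S t) t = deriv P t - δ * deriv S t :=
          ((hPd t).hasDerivAt.sub ((hSd t).hasDerivAt.const_mul δ)).deriv
        rw [hd]
        have e1 : ε * (1 + δ) * N t ≤ k / 2 * m * (P t + S t) := by
          calc ε * (1 + δ) * N t ≤ ε * (1 + δ) * (C * (P t + S t)) := by gcongr
            _ = ε * C * (1 + δ) * (P t + S t) := by ring
            _ = _ := by rw [hεC]
        have e2 : m * P t ≤ 1 * P t := mul_le_mul_of_nonneg_right (min_le_left _ _) (hP0 t)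
        have e3 : m * S t ≤ δ * S t := mul_le_mul_of_nonneg_right (min_le_right _ _) (hS0 t)
        have e4 : δ * deriv S t ≤ δ * (-(k * S t) + ε * N t) := by gcongr
        have e5 : k / 2 * (m * P t + m * S t) ≤ k / 2 * (1 * P t + δ * S t) := by gcongr
        have e6 : 0 ≤ k * (δ * S t) := mul_nonneg hk.le (mul_nonneg hδ.le (hS0 t))
        nlinarith
    filter_upwards [eventually_ge_atTop T] with t₀ ht₀
    -- Once positive, `P - δ * S` stays bounded below by its present value, against `P → 0`.
    by_contra! hlt
    have hq : 0 < P t₀ - δ * S t₀ := sub_pos.2 hlt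
    obtain ⟨t, ht, htP⟩ := ((eventually_ge_atTop t₀).and (hlim.eventually_lt_const hq)).exists
    have h1 := hmono (mem_Ici.2 ht₀) (mem_Ici.2 (ht₀.trans ht)) ht
    simp only at h1
    have h2 : Real.exp (-(k / 2 * t)) ≤ Real.exp (-(k / 2 * t₀)) := by gcongr
    have h3 := mul_le_mul_of_nonneg_right h2 hq.le
    have h4 := le_of_mul_le_mul_left (h3.trans h1) (Real.exp_pos _)
    nlinarith [mul_nonneg hδ.le (hS0 t)]
  refine ⟨key, ?_⟩
  obtain ⟨ε, hε, hεC⟩ : ∃ ε > 0, ε * C * 2 = k / 2 :=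
    ⟨k / 4 / C, by positivity, by field_simp; ring⟩
  obtain ⟨T, hT⟩ := eventually_atTop.1 ((hN.and (key 1 one_pos)).and (hS ε hε))
  have hmono := monotoneOn_exp_mul_of_le_deriv (f := fun t => -S t) (a := -(k / 2)) (T := T)
    hSd.neg fun t ht => by
      obtain ⟨⟨h1, h2⟩, h3⟩ := hT t ht
      have hd : deriv (fun t => -S t) t = -deriv S t := (hSd t).hasDerivAt.neg.deriv
      rw [hd]
      have e1 : ε * N t ≤ k / 2 * S t := by
        calc ε * N t ≤ ε * (C * (S t + S t)) := by
              refine mul_le_mul_of_nonneg_left (h1.trans ?_) hε.le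
              gcongr; linarith
          _ = ε * C * 2 * S t := by ring
          _ = _ := by rw [hεC]
      linarith
  refine ⟨Real.exp (k / 2 * T) * S T, ?_⟩
  filter_upwards [eventually_ge_atTop T] with t ht
  have h1 := hmono (mem_Ici.2 le_rfl) (mem_Ici.2 ht) ht
  simp only [neg_mul, neg_neg, mul_neg, neg_le_neg_iff] at h1
  rw [Real.exp_neg, ← div_eq_mul_inv, le_div_iff₀ (Real.exp_pos _)]
  linarith

/-! ### Quadratic forms of a scalar linear equation of the second order -/

/-- The smaller root of `X² + c X - μ`, for `0 < μ`. -/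
noncomputable def rootMinus (c μ : ℝ) : ℝ := (-c - √(c ^ 2 + 4 * μ)) / 2

/-- The part of the coordinates `(x, y)` that expands under `x' = y`, `y' = μ x - c y`: the square
of the unstable coordinate if `0 < μ` (a saddle), a positive definite form if `μ < 0` and `c < 0`
(a source), and `0` if `μ < 0` and `0 ≤ c`. -/
noncomputable def unstableForm (c μ x y : ℝ) : ℝ :=
  if 0 < μ then (y - rootMinus c μ * x) ^ 2
  else if c < 0 then (y + c * x / 2) ^ 2 + (c ^ 2 / 4 - μ) * x ^ 2 else 0

/-- The part of `(x, y)` that contracts under `x' = y`, `y' = μ x - c y`. Reversing the time changes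
`(c, x, y)` into `(-c, x, -y)`. -/
noncomputable def stableForm (c μ x y : ℝ) : ℝ := unstableForm (-c) μ x (-y)

/-- The part of `(x, y)` that rotates under `x' = y`, `y' = μ x - c y`. -/
noncomputable def centerForm (c μ x y : ℝ) : ℝ := if μ < 0 ∧ c = 0 then y ^ 2 - μ * x ^ 2 else 0

/-- A linear projection of `(x, y)` to the stable subspace of `x' = y`, `y' = μ x - c y`. For a
saddle it keeps `x`, so that the remainder is `(0, y - rootMinus c μ * x)`. -/
noncomputable def stableProj (c μ x y : ℝ) : ℝ × ℝ :=
  if 0 < μ then (x, rootMinus c μ * x) else if 0 < c then (x, y) else (0, 0)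

section Roots

variable {c μ : ℝ}

theorem rootMinus_sq (hμ : 0 < μ) : rootMinus c μ ^ 2 + c * rootMinus c μ = μ := by
  have h : √(c ^ 2 + 4 * μ) ^ 2 = c ^ 2 + 4 * μ := Real.sq_sqrt (by positivity)
  unfold rootMinus; nlinarith

theorem abs_lt_sqrt (hμ : 0 < μ) : |c| < √(c ^ 2 + 4 * μ) :=
  Real.lt_sqrt_of_sq_lt (by rw [sq_abs]; linarith)

theorem rootMinus_neg (hμ : 0 < μ) : rootMinus c μ < 0 := by
  have := abs_lt_sqrt (c := c) hμ
  have := neg_abs_le c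
  unfold rootMinus; linarith

/-- The larger root of `X² + c X - μ` is `-c - rootMinus c μ`. -/
theorem rootMinus_add_pos (hμ : 0 < μ) : 0 < -c - rootMinus c μ := by
  have := abs_lt_sqrt (c := c) hμ
  have := le_abs_self c
  unfold rootMinus; linarith

theorem rootMinus_add_rootMinus : rootMinus c μ - rootMinus (-c) μ = -c := by
  unfold rootMinus; rw [neg_sq]; ring

end Roots

theorem unstableForm_nonneg {c μ : ℝ} (x y : ℝ) : 0 ≤ unstableForm c μ x y := by
  unfold unstableForm
  split_ifs with h1 h2
  · positivity
  · have : 0 ≤ c ^ 2 / 4 - μ := by nlinarith [sq_nonneg c]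
    positivity
  · rfl

theorem stableForm_nonneg {c μ : ℝ} (x y : ℝ) : 0 ≤ stableForm c μ x y := unstableForm_nonneg _ _

/-- Along a solution of `x' = y`, `y' = μ x - c y + g`, the unstable form expands up to an error
controlled by `g`. -/
theorem unstableForm_le_deriv (c : ℝ) {μ : ℝ} (hμ : μ ≠ 0) :
    ∃ k > 0, ∃ C > 0, ∀ (x y : ℝ → ℝ) (t g : ℝ), HasDerivAt x (y t) t →
      HasDerivAt y (μ * x t - c * y t + g) t →
      DifferentiableAt ℝ (fun τ => unstableForm c μ (x τ) (y τ)) t ∧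
      ∀ r ε, 0 ≤ ε → |x t| ≤ r → |y t| ≤ r → |g| ≤ ε * r →
        k * unstableForm c μ (x t) (y t) - C * ε * r ^ 2 ≤
          deriv (fun τ => unstableForm c μ (x τ) (y τ)) t := by
  rcases hμ.lt_or_gt with h | h
  · rcases lt_or_ge c 0 with hc | hc
    · set K := 2 + c ^ 2 / (-μ) with hKdef
      have hK : 0 < K := by have : 0 < -μ := by linarith
                            positivity
      have hKμ : (K - 2) * (-μ) = c ^ 2 := by
        have : -μ ≠ 0 := by linarith
        rw [hKdef]; field_simp; ring
      refine ⟨-c / K, div_pos (by linarith) hK, 2 + |c|, by positivity, fun x y t g hx hy => ?_⟩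
      simp only [unstableForm, if_neg h.not_gt, if_pos hc]
      have hd := ((hy.add ((hx.const_mul c).div_const 2)).pow 2).add
        ((hx.pow 2).const_mul (c ^ 2 / 4 - μ))
      have hd' : HasDerivAt (fun τ => (y τ + c * x τ / 2) ^ 2 + (c ^ 2 / 4 - μ) * x τ ^ 2)
        (-c * (y t ^ 2 + -μ * x t ^ 2) + (2 * y t + c * x t) * g) t := by
        refine hd.congr_deriv ?_
        simp; ring
      refine ⟨hd'.differentiableAt, fun r ε hε hxr hyr hg => ?_⟩
      rw [hd'.deriv]
      have h0 : 0 ≤ r := (abs_nonneg _).trans hxr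
      have e1 : (y t + c * x t / 2) ^ 2 + (c ^ 2 / 4 - μ) * x t ^ 2 ≤
          K * (y t ^ 2 + -μ * x t ^ 2) := by
        have a1 : 0 ≤ (K - 2) * y t ^ 2 := by
          have : 0 ≤ K - 2 := by rw [hKdef]; have : 0 < -μ := by linarith
                                 simp; positivity
          positivity
        have a2 : K * (-μ * x t ^ 2) = (c ^ 2 + 2 * -μ) * x t ^ 2 := by rw [← hKμ]; ring
        nlinarith [sq_nonneg (y t - c * x t / 2), sq_nonneg (x t),
          mul_nonneg (neg_nonneg.2 h.le) (sq_nonneg (x t)), sq_nonneg (c * x t)]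
      have e2 : -c / K * ((y t + c * x t / 2) ^ 2 + (c ^ 2 / 4 - μ) * x t ^ 2) ≤
          -c * (y t ^ 2 + -μ * x t ^ 2) := by
        have : 0 ≤ -c / K := (div_pos (by linarith) hK).le
        calc _ ≤ -c / K * (K * (y t ^ 2 + -μ * x t ^ 2)) := by gcongr
          _ = _ := by field_simp
      have e3 : |(2 * y t + c * x t) * g| ≤ (2 + |c|) * ε * r ^ 2 := by
        rw [abs_mul]
        calc _ ≤ ((2 + |c|) * r) * (ε * r) := by
              refine mul_le_mul ?_ hg (abs_nonneg _) (by positivity)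
              calc |2 * y t + c * x t| ≤ |2 * y t| + |c * x t| := abs_add_le _ _
                _ = 2 * |y t| + |c| * |x t| := by rw [abs_mul, abs_mul, abs_two]
                _ ≤ 2 * r + |c| * r := by gcongr
                _ = _ := by ring
          _ = _ := by ring
      linarith [neg_abs_le ((2 * y t + c * x t) * g)]
    · refine ⟨1, one_pos, 1, one_pos, fun x y t g _ _ => ?_⟩
      simp only [unstableForm, if_neg h.not_gt, if_neg hc.not_gt]
      refine ⟨differentiableAt_const _, fun r ε hε _ _ _ => ?_⟩
      rw [deriv_const]
      have : 0 ≤ 1 * ε * r ^ 2 := by positivity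
      linarith
  · have hq := rootMinus_sq (c := c) h
    have hp := rootMinus_add_pos (c := c) h
    set l := rootMinus c μ with hl
    refine ⟨2 * (-c - l), by linarith, 2 * (1 + |l|), by positivity, fun x y t g hx hy => ?_⟩
    simp only [unstableForm, if_pos h, ← hl]
    have hd := (hy.sub (hx.const_mul l)).pow 2
    have hd' : HasDerivAt (fun τ => (y τ - l * x τ) ^ 2)
        (2 * (-c - l) * (y t - l * x t) ^ 2 + 2 * (y t - l * x t) * g) t := by
      refine hd.congr_deriv ?_
      simp
      rw [← hq]; ring
    refine ⟨hd'.differentiableAt, fun r ε hε hxr hyr hg => ?_⟩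
    rw [hd'.deriv]
    have h0 : 0 ≤ r := (abs_nonneg _).trans hxr
    have e3 : |2 * (y t - l * x t) * g| ≤ 2 * (1 + |l|) * ε * r ^ 2 := by
      rw [abs_mul]
      calc _ ≤ (2 * (1 + |l|) * r) * (ε * r) := by
            refine mul_le_mul ?_ hg (abs_nonneg _) (by positivity)
            rw [abs_mul, abs_two]
            calc 2 * |y t - l * x t| ≤ 2 * (|y t| + |l * x t|) := by gcongr; exact abs_sub _ _
              _ = 2 * (|y t| + |l| * |x t|) := by rw [abs_mul]
              _ ≤ 2 * (r + |l| * r) := by gcongr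
              _ = _ := by ring
        _ = _ := by ring
    linarith [neg_abs_le (2 * (y t - l * x t) * g)]

theorem deriv_stableForm_le (c : ℝ) {μ : ℝ} (hμ : μ ≠ 0) :
    ∃ k > 0, ∃ C > 0, ∀ (x y : ℝ → ℝ) (t g : ℝ), HasDerivAt x (y t) t →
      HasDerivAt y (μ * x t - c * y t + g) t →
      DifferentiableAt ℝ (fun τ => stableForm c μ (x τ) (y τ)) t ∧
      ∀ r ε, 0 ≤ ε → |x t| ≤ r → |y t| ≤ r → |g| ≤ ε * r →
        deriv (fun τ => stableForm c μ (x τ) (y τ)) t ≤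
          -(k * stableForm c μ (x t) (y t)) + C * ε * r ^ 2 := by
  obtain ⟨k, hk, C, hC, h⟩ := unstableForm_le_deriv (-c) hμ
  refine ⟨k, hk, C, hC, fun x y t g hx hy => ?_⟩
  -- The reversed curve `τ ↦ (x (-τ), -y (-τ))` solves the equation with `-c` in place of `c`.
  obtain ⟨h1, h2⟩ := h (fun τ => x (-τ)) (fun τ => -y (-τ)) (-t) g
    (by simpa using hx.comp_neg_at) (by simpa using hy.comp_neg_at.fun_neg)
  have hcomp : (fun τ => stableForm c μ (x τ) (y τ)) =
      (fun τ => unstableForm (-c) μ (x (-τ)) (-y (-τ))) ∘ fun τ => -τ := by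
    ext τ; simp [stableForm]
  have hd := HasDerivAt.scomp t h1.hasDerivAt (hasDerivAt_neg t)
  rw [← hcomp] at hd
  refine ⟨hd.differentiableAt, fun r ε hε hxr hyr hg => ?_⟩
  have := h2 r ε hε (by simpa using hxr) (by simpa using hyr) hg
  rw [hd.deriv]
  simp only [neg_neg] at this
  simp only [smul_eq_mul, neg_mul, one_mul, stableForm]
  linarith

theorem unstableForm_le (c μ : ℝ) : ∃ C > 0, ∀ x y, unstableForm c μ x y ≤ C * (x ^ 2 + y ^ 2) := by
  refine ⟨2 + 2 * rootMinus c μ ^ 2 + c ^ 2 + |μ|, by positivity, fun x y => ?_⟩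
  have hx := sq_nonneg x
  have hy := sq_nonneg y
  have h3 := mul_nonneg (sq_nonneg (rootMinus c μ)) hy
  have h4 := mul_nonneg (sq_nonneg (rootMinus c μ)) hx
  have h5 := mul_nonneg (sq_nonneg c) hy
  have h6 := mul_nonneg (sq_nonneg c) hx
  have h7 := mul_nonneg (abs_nonneg μ) hy
  have h8 := mul_nonneg (abs_nonneg μ) hx
  have h9 := mul_le_mul_of_nonneg_right (neg_abs_le μ) hx
  unfold unstableForm
  split_ifs
  · nlinarith [sq_nonneg (y + rootMinus c μ * x)]
  · nlinarith [sq_nonneg (y - c * x / 2)]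
  · nlinarith

theorem stableForm_le (c μ : ℝ) : ∃ C > 0, ∀ x y, stableForm c μ x y ≤ C * (x ^ 2 + y ^ 2) := by
  obtain ⟨C, hC, h⟩ := unstableForm_le (-c) μ
  exact ⟨C, hC, fun x y => by simpa [stableForm] using h x (-y)⟩

theorem sq_add_sq_le_saddle {l m : ℝ} (hlm : l ≠ m) :
    ∃ C > 0, ∀ x y : ℝ, x ^ 2 + y ^ 2 ≤ C * ((y - l * x) ^ 2 + (y - m * x) ^ 2) := by
  have h : 0 < (l - m) ^ 2 := by have := sub_ne_zero.2 hlm; positivity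
  refine ⟨2 * (1 + 2 * l ^ 2) / (l - m) ^ 2 + 2, by positivity, fun x y => ?_⟩
  have e1 : (l - m) ^ 2 * x ^ 2 ≤ 2 * ((y - l * x) ^ 2 + (y - m * x) ^ 2) := by
    nlinarith [sq_nonneg ((y - l * x) + (y - m * x))]
  have e2 : x ^ 2 ≤ 2 * ((y - l * x) ^ 2 + (y - m * x) ^ 2) / (l - m) ^ 2 := by
    rw [le_div_iff₀ h]; linarith
  have e3 : y ^ 2 ≤ 2 * ((y - l * x) ^ 2 + (y - m * x) ^ 2) + 2 * l ^ 2 * x ^ 2 := by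
    nlinarith [sq_nonneg ((y - l * x) - l * x), sq_nonneg (y - m * x)]
  have e4 := mul_le_mul_of_nonneg_left e2 (show 0 ≤ 1 + 2 * l ^ 2 by positivity)
  calc x ^ 2 + y ^ 2 ≤ (1 + 2 * l ^ 2) * (2 * ((y - l * x) ^ 2 + (y - m * x) ^ 2) / (l - m) ^ 2)
        + 2 * ((y - l * x) ^ 2 + (y - m * x) ^ 2) := by linarith
    _ = _ := by field_simp

theorem sq_add_sq_le_focus (c : ℝ) {μ : ℝ} (hμ : μ < 0) :
    ∃ C > 0, ∀ x y : ℝ, x ^ 2 + y ^ 2 ≤ C * ((y + c * x / 2) ^ 2 + (c ^ 2 / 4 - μ) * x ^ 2) := by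
  have h : 0 < -μ := by linarith
  refine ⟨2 + (1 + c ^ 2) / (-μ), by positivity, fun x y => ?_⟩
  have e0 : y ^ 2 ≤ 2 * (y + c * x / 2) ^ 2 + c ^ 2 * x ^ 2 := by
    nlinarith [sq_nonneg (y + c * x), sq_nonneg (c * x)]
  have e1 : (1 + c ^ 2) * x ^ 2 = (1 + c ^ 2) / (-μ) * (-μ * x ^ 2) := by
    rw [div_mul_eq_mul_div, eq_div_iff h.ne']; ring
  have e2 : (1 + c ^ 2) / (-μ) * (-μ * x ^ 2) ≤
      (1 + c ^ 2) / (-μ) * ((y + c * x / 2) ^ 2 + (c ^ 2 / 4 - μ) * x ^ 2) := by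
    gcongr
    nlinarith [sq_nonneg (y + c * x / 2), sq_nonneg (c * x)]
  have e3 : 0 ≤ (c ^ 2 / 4 - μ) * x ^ 2 := by
    have : 0 ≤ c ^ 2 / 4 - μ := by nlinarith [sq_nonneg c]
    positivity
  nlinarith

theorem stableForm_of_pos (c : ℝ) {μ : ℝ} (hμ : 0 < μ) (x y : ℝ) :
    stableForm c μ x y = (y - (-c - rootMinus c μ) * x) ^ 2 := by
  have := rootMinus_add_rootMinus (c := c) (μ := μ)
  have e : rootMinus (-c) μ = c + rootMinus c μ := by linarith
  rw [stableForm, unstableForm, if_pos hμ, e]; ring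

theorem sq_add_sq_le_forms (c : ℝ) {μ : ℝ} (hμ : μ ≠ 0) :
    ∃ C > 0, ∀ x y, x ^ 2 + y ^ 2 ≤
      C * (unstableForm c μ x y + stableForm c μ x y + centerForm c μ x y) := by
  rcases hμ.lt_or_gt with h | h
  · obtain ⟨C, hC, hb⟩ := sq_add_sq_le_focus c h
    refine ⟨C, hC, fun x y => (hb x y).trans (le_of_eq ?_)⟩
    rcases lt_trichotomy c 0 with hc | rfl | hc
    · simp [unstableForm, stableForm, centerForm, h.not_gt, hc, hc.not_gt, hc.ne]
    · simp [unstableForm, stableForm, centerForm, h.not_gt, h]; left; ring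
    · simp [unstableForm, stableForm, centerForm, h.not_gt, hc, hc.not_gt, hc.ne']; left; ring
  · obtain ⟨C, hC, hb⟩ := sq_add_sq_le_saddle (l := rootMinus c μ) (m := -c - rootMinus c μ)
      ((rootMinus_neg h).trans (rootMinus_add_pos h)).ne
    refine ⟨C, hC, fun x y => (hb x y).trans (le_of_eq ?_)⟩
    rw [stableForm_of_pos c h]
    simp [unstableForm, centerForm, h, h.not_gt]

theorem stableProj_sub_le (c : ℝ) {μ : ℝ} (hμ : μ ≠ 0) :
    ∃ C > 0, ∀ x y, (x - (stableProj c μ x y).1) ^ 2 + (y - (stableProj c μ x y).2) ^ 2 ≤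
      C * (unstableForm c μ x y + centerForm c μ x y) := by
  rcases hμ.lt_or_gt with h | h
  · obtain ⟨C, hC, hb⟩ := sq_add_sq_le_focus c h
    refine ⟨C, hC, fun x y => ?_⟩
    have := hb x y
    rcases lt_trichotomy c 0 with hc | rfl | hc
    · simpa [unstableForm, stableProj, centerForm, h.not_gt, hc, hc.not_gt, hc.ne] using this
    · simp [unstableForm, stableProj, centerForm, h.not_gt, h] at this ⊢; linarith
    · simp [unstableForm, stableProj, centerForm, h.not_gt, hc, hc.not_gt, hc.ne']
  · refine ⟨1, one_pos, fun x y => le_of_eq ?_⟩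
    simp [unstableForm, stableProj, centerForm, h, h.not_gt]

/-- For `c = 0` and `0 < μ`, the energy `y ^ 2 - μ x ^ 2` is the product of the stable and unstable
coordinates. -/
theorem centerForm_zero_le {μ θ : ℝ} (hμ : μ ≠ 0) (hθ : 0 < θ) (x y : ℝ) :
    centerForm 0 μ x y ≤
      (y ^ 2 - μ * x ^ 2) + (unstableForm 0 μ x y / θ + θ * stableForm 0 μ x y) := by
  rcases hμ.lt_or_gt with h | h
  · simp [centerForm, h, unstableForm, stableForm, h.not_gt]
  · have hq := rootMinus_sq (c := 0) h
    rw [stableForm_of_pos 0 h]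
    simp only [centerForm, unstableForm, h, h.not_gt, false_and, if_false, if_true]
    set p := y - rootMinus 0 μ * x with hp
    set s := y - (-0 - rootMinus 0 μ) * x with hs
    have e : y ^ 2 - μ * x ^ 2 = p * s := by rw [← hq, hp, hs]; ring
    rw [e]
    have : p * s + (p ^ 2 / θ + θ * s ^ 2) = ((p + θ * s) ^ 2 + p ^ 2 + (θ * s) ^ 2) / (2 * θ) := by
      field_simp; ring
    rw [this]; positivity

theorem centerForm_of_ne {c : ℝ} (hc : c ≠ 0) (μ x y : ℝ) : centerForm c μ x y = 0 := by
  simp [centerForm, hc]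

/-! ### Coupled systems of scalar equations -/

theorem exists_pos_forall_le {ι : Type*} [Fintype ι] {k : ι → ℝ} (hk : ∀ i, 0 < k i) :
    ∃ k₀ > 0, ∀ i, k₀ ≤ k i := by
  have h : ∀ᶠ z in 𝓝[>] (0 : ℝ), ∀ i, z ≤ k i := eventually_all.2 fun i =>
    ((eventually_lt_nhds (hk i)).filter_mono nhdsWithin_le_nhds).mono fun _ h => h.le
  obtain ⟨z, hz, hz0⟩ := (h.and self_mem_nhdsWithin).exists
  exact ⟨z, hz0, hz⟩

theorem exists_pos_forall_ge {ι : Type*} [Fintype ι] (C : ι → ℝ) : ∃ C₀ > 0, ∀ i, C i ≤ C₀ := by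
  obtain ⟨z, hz, hz0⟩ := ((eventually_all.2 fun i => eventually_ge_atTop (C i)).and
    (eventually_gt_atTop (0 : ℝ))).exists
  exact ⟨z, hz0, hz⟩

/-- Small solutions of `x i' = y i`, `y i' = μ i * x i - c * y i + o(√N)`, where `N` is the square
of the norm of the solution, decay exponentially and tangentially to the stable subspace. If
`c = 0`, the coordinates with `μ i < 0` are controlled by an approximate conservation of energy. -/
theorem decay_of_coordinates {ι : Type*} [Fintype ι] {c : ℝ} {μ : ι → ℝ} (hμ : ∀ i, μ i ≠ 0)
    {x y g : ι → ℝ → ℝ} {N : ℝ → ℝ} (hN : ∀ t, N t = ∑ i, (x i t ^ 2 + y i t ^ 2))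
    (hx : ∀ i t, HasDerivAt (x i) (y i t) t)
    (hy : ∀ i t, HasDerivAt (y i) (μ i * x i t - c * y i t + g i t) t)
    (hg : ∀ ε > 0, ∀ᶠ t in atTop, ∀ i, |g i t| ≤ ε * √(N t))
    (hlim : Tendsto N atTop (𝓝 0))
    (hE : c = 0 → ∀ ε > 0, ∀ᶠ t in atTop, ∑ i, (y i t ^ 2 - μ i * x i t ^ 2) ≤ ε * N t) :
    (∃ β > 0, ∃ K, ∀ᶠ t in atTop, N t ≤ K * Real.exp (-(β * t))) ∧
      ∀ ε > 0, ∀ᶠ t in atTop, ∑ i, ((x i t - (stableProj c (μ i) (x i t) (y i t)).1) ^ 2 +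
        (y i t - (stableProj c (μ i) (x i t) (y i t)).2) ^ 2) ≤ ε * N t := by
  have hN0 : ∀ t, 0 ≤ N t := fun t => by
    rw [hN]; exact Finset.sum_nonneg fun i _ => by positivity
  have hxN : ∀ i t, |x i t| ≤ √(N t) := fun i t => by
    refine Real.abs_le_sqrt ?_
    rw [hN]
    refine le_trans ?_ (Finset.single_le_sum (fun i _ => ?_) (Finset.mem_univ i))
    · linarith [sq_nonneg (y i t)]
    · positivity
  have hyN : ∀ i t, |y i t| ≤ √(N t) := fun i t => by
    refine Real.abs_le_sqrt ?_
    rw [hN]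
    refine le_trans ?_ (Finset.single_le_sum (fun i _ => ?_) (Finset.mem_univ i))
    · linarith [sq_nonneg (x i t)]
    · positivity
  choose k₁ hk₁ C₁ hC₁ h₁ using fun i => unstableForm_le_deriv c (hμ i)
  choose k₂ hk₂ C₂ hC₂ h₂ using fun i => deriv_stableForm_le c (hμ i)
  choose C₃ hC₃ h₃ using fun i => unstableForm_le c (μ i)
  choose C₄ hC₄ h₄ using fun i => stableForm_le c (μ i)
  choose C₅ hC₅ h₅ using fun i => sq_add_sq_le_forms c (hμ i)
  choose C₆ hC₆ h₆ using fun i => stableProj_sub_le c (hμ i)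
  obtain ⟨a₁, ha₁, hka₁⟩ := exists_pos_forall_le hk₁
  obtain ⟨a₂, ha₂, hka₂⟩ := exists_pos_forall_le hk₂
  obtain ⟨K₃, hK₃, hCK₃⟩ := exists_pos_forall_ge C₃
  obtain ⟨K₄, hK₄, hCK₄⟩ := exists_pos_forall_ge C₄
  obtain ⟨K₅, hK₅, hCK₅⟩ := exists_pos_forall_ge C₅
  obtain ⟨K₆, hK₆, hCK₆⟩ := exists_pos_forall_ge C₆
  set P : ℝ → ℝ := fun t => ∑ i, unstableForm c (μ i) (x i t) (y i t) with hPdef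
  set S : ℝ → ℝ := fun t => ∑ i, stableForm c (μ i) (x i t) (y i t) with hSdef
  set Z : ℝ → ℝ := fun t => ∑ i, centerForm c (μ i) (x i t) (y i t) with hZdef
  set k := min a₁ a₂
  have hk : 0 < k := lt_min ha₁ ha₂
  have hP0 : ∀ t, 0 ≤ P t := fun t => Finset.sum_nonneg fun i _ => unstableForm_nonneg _ _
  have hS0 : ∀ t, 0 ≤ S t := fun t => Finset.sum_nonneg fun i _ => stableForm_nonneg _ _
  have hZ0 : ∀ i t, 0 ≤ centerForm c (μ i) (x i t) (y i t) := fun i t => by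
    unfold centerForm
    split_ifs with h
    · nlinarith [sq_nonneg (y i t), mul_nonneg (neg_nonneg.2 h.1.le) (sq_nonneg (x i t))]
    · rfl
  have hdP : ∀ t, HasDerivAt P
      (∑ i, deriv (fun τ => unstableForm c (μ i) (x i τ) (y i τ)) t) t := fun t =>
    HasDerivAt.fun_sum fun i _ => (h₁ i (x i) (y i) t (g i t) (hx i t) (hy i t)).1.hasDerivAt
  have hdS : ∀ t, HasDerivAt S
      (∑ i, deriv (fun τ => stableForm c (μ i) (x i τ) (y i τ)) t) t := fun t =>
    HasDerivAt.fun_sum fun i _ => (h₂ i (x i) (y i) t (g i t) (hx i t) (hy i t)).1.hasDerivAt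
  have hPN : ∀ t, P t ≤ K₃ * N t := fun t => by
    rw [hN, Finset.mul_sum]
    exact Finset.sum_le_sum fun i _ => (h₃ i _ _).trans
      (mul_le_mul_of_nonneg_right (hCK₃ i) (by positivity))
  have hSN : ∀ t, S t ≤ K₄ * N t := fun t => by
    rw [hN, Finset.mul_sum]
    exact Finset.sum_le_sum fun i _ => (h₄ i _ _).trans
      (mul_le_mul_of_nonneg_right (hCK₄ i) (by positivity))
  have hNZ : ∀ t, N t ≤ K₅ * (P t + S t + Z t) := fun t => by
    rw [hN, hPdef, hSdef, hZdef, ← Finset.sum_add_distrib, ← Finset.sum_add_distrib,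
      Finset.mul_sum]
    exact Finset.sum_le_sum fun i _ => (h₅ i _ _).trans (mul_le_mul_of_nonneg_right (hCK₅ i)
      (add_nonneg (add_nonneg (unstableForm_nonneg _ _) (stableForm_nonneg _ _)) (hZ0 i t)))
  have hDZ : ∀ t, ∑ i, ((x i t - (stableProj c (μ i) (x i t) (y i t)).1) ^ 2 +
        (y i t - (stableProj c (μ i) (x i t) (y i t)).2) ^ 2) ≤ K₆ * (P t + Z t) := fun t => by
    rw [hPdef, hZdef, ← Finset.sum_add_distrib, Finset.mul_sum]
    exact Finset.sum_le_sum fun i _ => (h₆ i _ _).trans (mul_le_mul_of_nonneg_right (hCK₆ i)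
      (add_nonneg (unstableForm_nonneg _ _) (hZ0 i t)))
  have hZ : ∀ ε > 0, ∀ θ > 0, ∀ᶠ t in atTop, Z t ≤ ε * N t + (P t / θ + θ * S t) := by
    intro ε hε θ hθ
    by_cases hc : c = 0
    · filter_upwards [hE hc ε hε] with t ht
      refine le_trans ?_ (add_le_add_left ht _)
      rw [hZdef, hPdef, hSdef, Finset.sum_div, Finset.mul_sum, ← Finset.sum_add_distrib,
        ← Finset.sum_add_distrib]
      subst hc
      exact Finset.sum_le_sum fun i _ => centerForm_zero_le (hμ i) hθ _ _
    · refine .of_forall fun t => ?_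
      have : Z t = 0 := Finset.sum_eq_zero fun i _ => centerForm_of_ne hc _ _ _
      rw [this]
      have := hN0 t
      have := hP0 t
      have := hS0 t
      positivity
  have hNPS : ∀ᶠ t in atTop, N t ≤ 4 * K₅ * (P t + S t) := by
    filter_upwards [hZ (1 / (2 * K₅)) (by positivity) 1 one_pos] with t ht
    have e1 := mul_le_mul_of_nonneg_left ht hK₅.le
    have e2 : K₅ * (1 / (2 * K₅) * N t + (P t / 1 + 1 * S t)) = N t / 2 + K₅ * (P t + S t) := by
      field_simp
    linarith [hNZ t]
  have hPd : ∀ ε > 0, ∀ᶠ t in atTop, k * P t - ε * N t ≤ deriv P t := by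
    intro ε hε
    have hC : 0 ≤ ∑ i, C₁ i := Finset.sum_nonneg fun i _ => (hC₁ i).le
    filter_upwards [hg (ε / (1 + ∑ i, C₁ i)) (by positivity)] with t ht
    rw [(hdP t).deriv]
    have e := Finset.sum_le_sum fun i (_ : i ∈ Finset.univ) =>
      (h₁ i (x i) (y i) t (g i t) (hx i t) (hy i t)).2 _ _ (by positivity) (hxN i t) (hyN i t) (ht i)
    refine le_trans ?_ e
    rw [Finset.sum_sub_distrib, ← Finset.sum_mul, ← Finset.sum_mul, Real.sq_sqrt (hN0 t)]
    refine sub_le_sub ?_ (mul_le_mul_of_nonneg_right ?_ (hN0 t))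
    · rw [hPdef, Finset.mul_sum]
      exact Finset.sum_le_sum fun i _ => mul_le_mul_of_nonneg_right
        ((min_le_left _ _).trans (hka₁ i)) (unstableForm_nonneg _ _)
    · rw [mul_div_assoc', div_le_iff₀ (by positivity)]
      nlinarith
  have hSd : ∀ ε > 0, ∀ᶠ t in atTop, deriv S t ≤ -(k * S t) + ε * N t := by
    intro ε hε
    have hC : 0 ≤ ∑ i, C₂ i := Finset.sum_nonneg fun i _ => (hC₂ i).le
    filter_upwards [hg (ε / (1 + ∑ i, C₂ i)) (by positivity)] with t ht
    rw [(hdS t).deriv]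
    have e := Finset.sum_le_sum fun i (_ : i ∈ Finset.univ) =>
      (h₂ i (x i) (y i) t (g i t) (hx i t) (hy i t)).2 _ _ (by positivity) (hxN i t) (hyN i t) (ht i)
    refine e.trans ?_
    rw [Finset.sum_add_distrib, ← Finset.sum_mul, ← Finset.sum_mul, Real.sq_sqrt (hN0 t),
      Finset.sum_neg_distrib]
    refine add_le_add (neg_le_neg ?_) (mul_le_mul_of_nonneg_right ?_ (hN0 t))
    · rw [hSdef, Finset.mul_sum]
      exact Finset.sum_le_sum fun i _ => mul_le_mul_of_nonneg_right
        ((min_le_right _ _).trans (hka₂ i)) (stableForm_nonneg _ _)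
    · rw [mul_div_assoc', div_le_iff₀ (by positivity)]
      nlinarith
  have hPlim : Tendsto P atTop (𝓝 0) :=
    squeeze_zero hP0 hPN (by simpa using hlim.const_mul K₃)
  obtain ⟨hPS, K, hK⟩ := eventually_le_of_expanding_contracting hk
    (show 0 < 4 * K₅ by positivity) (fun t => (hdP t).differentiableAt)
    (fun t => (hdS t).differentiableAt) hP0 hS0 hNPS hPd hSd hPlim
  constructor
  · refine ⟨k / 2, by positivity, 4 * K₅ * (2 * K), ?_⟩
    filter_upwards [hNPS, hPS 1 one_pos, hK] with t e1 e2 e3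
    have : P t + S t ≤ 2 * (K * Real.exp (-(k / 2 * t))) := by linarith
    calc N t ≤ 4 * K₅ * (P t + S t) := e1
      _ ≤ 4 * K₅ * (2 * (K * Real.exp (-(k / 2 * t)))) := by gcongr
      _ = _ := by ring
  · intro ε hε
    obtain ⟨η, hη, hηε⟩ : ∃ η > 0, K₆ * (K₄ * η) = ε / 4 :=
      ⟨ε / 4 / (K₆ * K₄), by positivity, by field_simp⟩
    -- The weight `η` makes the cross term `η * S` small; `P ≤ η ^ 2 * S` absorbs `P / η`.
    filter_upwards [hZ (ε / (4 * K₆)) (by positivity) η hη, hPS η hη, hPS (η ^ 2) (by positivity)]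
      with t e1 e2 e3
    have e4 : P t / η ≤ η * S t := by rw [div_le_iff₀ hη]; linarith
    have e5 : P t + Z t ≤ ε / (4 * K₆) * N t + 3 * (η * (K₄ * N t)) := by
      have := mul_le_mul_of_nonneg_left (hSN t) hη.le
      linarith
    calc _ ≤ K₆ * (P t + Z t) := hDZ t
      _ ≤ K₆ * (ε / (4 * K₆) * N t + 3 * (η * (K₄ * N t))) := by gcongr
      _ = K₆ * (ε / (4 * K₆)) * N t + 3 * (K₆ * (K₄ * η)) * N t := by ring
      _ = ε * N t := by rw [hηε]; field_simp; ring

/-! ### Convergence of the velocity -/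

/-- If `u` converges and `u'' = -c u' + G` with `G → 0`, then `u' → 0`: on `[ξ, ξ + 1]` the
variation of `u' + c u` is small, so that `u'(ξ)` is close to `u (ξ + 1) - u ξ`. -/
theorem tendsto_velocity_zero {F : Type*} [NormedAddCommGroup F] [NormedSpace ℝ F]
    {u v G : ℝ → F} {c : ℝ} {e : F} (hu : ∀ t, HasDerivAt u (v t) t)
    (hv : ∀ t, HasDerivAt v (-(c • v t) + G t) t) (hlim : Tendsto u atTop (𝓝 e))
    (hG : Tendsto G atTop (𝓝 0)) : Tendsto v atTop (𝓝 0) := by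
  rw [NormedAddGroup.tendsto_nhds_zero]
  intro ε hε
  obtain ⟨η, hη, hηε⟩ : ∃ η > 0, (3 + 2 * |c|) * η < ε :=
    ⟨ε / 2 / (3 + 2 * |c|), by positivity, by
      rw [mul_div_cancel₀ _ (by positivity)]; linarith⟩
  have h1 : ∀ᶠ t in atTop, ‖G t‖ < η := NormedAddGroup.tendsto_nhds_zero.1 hG η hη
  have h2 : ∀ᶠ t in atTop, ‖u t - e‖ < η := by
    simpa [dist_eq_norm] using Metric.tendsto_nhds.1 hlim η hη
  obtain ⟨T, hT⟩ := eventually_atTop.1 (h1.and h2)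
  filter_upwards [eventually_ge_atTop T] with ξ hξ
  have hvar : ∀ t ∈ Icc ξ (ξ + 1), ‖v t - v ξ‖ ≤ (1 + 2 * |c|) * η := by
    intro t ht
    have hd : ∀ s, HasDerivAt (fun s => v s + c • (u s - e)) (G s) s := fun s =>
      ((hv s).fun_add (((hu s).sub_const e).const_smul c)).congr_deriv (by abel)
    have e1 := norm_image_sub_le_of_norm_deriv_le_segment' (a := ξ) (b := ξ + 1) (C := η)
      (fun s _ => (hd s).hasDerivWithinAt) (fun s hs => (hT s (hξ.trans hs.1)).1.le) t ht
    have e2 : η * (t - ξ) ≤ η := by nlinarith [ht.2]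
    have e3 : v t - v ξ =
        (v t + c • (u t - e) - (v ξ + c • (u ξ - e))) + (c • (u ξ - e) - c • (u t - e)) := by abel
    have e4 : ‖c • (u ξ - e) - c • (u t - e)‖ ≤ |c| * η + |c| * η := by
      refine (norm_sub_le _ _).trans ?_
      rw [norm_smul, norm_smul, Real.norm_eq_abs]
      gcongr
      · exact (hT ξ hξ).2.le
      · exact (hT t (hξ.trans ht.1)).2.le
    rw [e3]
    refine (norm_add_le _ _).trans ?_
    linarith
  have hd : ∀ s, HasDerivAt (fun s => u s - s • v ξ) (v s - v ξ) s := fun s =>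
    ((hu s).fun_sub ((hasDerivAt_id s).smul_const (v ξ))).congr_deriv (by simp)
  have e1 := norm_image_sub_le_of_norm_deriv_le_segment' (a := ξ) (b := ξ + 1)
    (fun s _ => (hd s).hasDerivWithinAt) (fun s hs => hvar s ⟨hs.1, hs.2.le⟩) (ξ + 1)
    ⟨by linarith, le_rfl⟩
  have e2 : v ξ = ((u (ξ + 1) - e) - (u ξ - e)) -
      (u (ξ + 1) - (ξ + 1) • v ξ - (u ξ - ξ • v ξ)) := by
    rw [add_smul, one_smul]; abel
  rw [e2]
  refine lt_of_le_of_lt ((norm_sub_le _ _).trans (add_le_add (norm_sub_le _ _) e1)) ?_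
  have := (hT ξ hξ).2
  have := (hT (ξ + 1) (by linarith)).2
  linarith

/-! ### The Hessian and the linearized vector field -/

section Hessian

variable {d : ℕ} {V : Rd d → ℝ} {e : Rd d}

theorem contDiff_gradient (hV : ContDiff ℝ 2 V) : ContDiff ℝ 1 (∇ V) :=
  (InnerProductSpace.toDual ℝ (Rd d)).symm.toContinuousLinearEquiv.contDiff.comp
    (hV.fderiv_right (m := 1) (by norm_num))

theorem hasFDerivAt_gradient (hV : ContDiff ℝ 2 V) (z : Rd d) :
    HasFDerivAt (∇ V) (fderiv ℝ (∇ V) z) z :=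
  ((contDiff_gradient hV).differentiable one_ne_zero z).hasFDerivAt

theorem hasFDerivAt_potential (hV : ContDiff ℝ 2 V) (z : Rd d) :
    HasFDerivAt V (innerSL ℝ (∇ V z)) z := by
  have h := (hV.differentiable two_ne_zero z).hasFDerivAt
  refine h.congr_fderiv ?_
  ext w
  exact inner_gradient_left.symm

theorem inner_hessian (hV : ContDiff ℝ 2 V) (a b : Rd d) :
    inner ℝ (fderiv ℝ (∇ V) e a) b = fderiv ℝ (fderiv ℝ V) e a b := by
  have h1 : HasFDerivAt (fun z => inner ℝ (∇ V z) b) _ e :=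
    (hasFDerivAt_gradient hV e).inner ℝ (hasFDerivAt_const b e)
  have h2 : HasFDerivAt (fun z => fderiv ℝ V z b) _ e :=
    ((hV.fderiv_right (m := 1) (by norm_num)).differentiable one_ne_zero e).hasFDerivAt.clm_apply
      (hasFDerivAt_const b e)
  have h3 : (fun z => inner ℝ (∇ V z) b) = fun z => fderiv ℝ V z b :=
    funext fun z => inner_gradient_left
  rw [h3] at h1
  simpa using congrArg (fun L => L a) (h1.unique h2)

theorem isSymmetric_hessian (hV : ContDiff ℝ 2 V) :
    (fderiv ℝ (∇ V) e).toLinearMap.IsSymmetric := fun a b => by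
  have hs := hV.contDiffAt (x := e).isSymmSndFDerivAt (by simp)
  change inner ℝ (fderiv ℝ (∇ V) e a) b = inner ℝ a (fderiv ℝ (∇ V) e b)
  rw [inner_hessian hV, real_inner_comm, inner_hessian hV]
  exact hs a b

/-- The second order Taylor expansion of the potential at a critical point. -/
theorem eventually_taylor_potential (hV : ContDiff ℝ 2 V) (he : ∇ V e = 0) {ε : ℝ} (hε : 0 < ε) :
    ∀ᶠ z in 𝓝 e, |2 * (V z - V e) - inner ℝ (z - e) (fderiv ℝ (∇ V) e (z - e))| ≤
      ε * ‖z - e‖ ^ 2 := by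
  set H := fderiv ℝ (∇ V) e
  have hlo := (hasFDerivAt_gradient hV e).isLittleO.def (half_pos hε)
  obtain ⟨ρ, hρ, hball⟩ := Metric.eventually_nhds_iff.1 hlo
  refine Metric.eventually_nhds_iff.2 ⟨ρ, hρ, fun z hz => ?_⟩
  have hd : ∀ w, HasFDerivAt (fun w => 2 * (V w - V e) - inner ℝ (w - e) (H (w - e)))
      (2 • innerSL ℝ (∇ V w - ∇ V e - H (w - e))) w := fun w => by
    have h1 : HasFDerivAt (fun w => w - e) (ContinuousLinearMap.id ℝ (Rd d)) w :=
      (hasFDerivAt_id w).sub_const e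
    have h2 := (((hasFDerivAt_potential hV w).sub_const (V e)).const_mul 2).fun_sub
      (h1.inner ℝ (H.hasFDerivAt.comp w h1))
    refine h2.congr_fderiv ?_
    ext a
    have hs : inner ℝ (H (w - e)) a = inner ℝ (w - e) (H a) := isSymmetric_hessian hV (w - e) a
    simp [he, inner_sub_left, fderivInnerCLM_apply] at hs ⊢
    rw [real_inner_comm (H w - H e) a, inner_sub_left]
    linarith
  have hmv := Convex.norm_image_sub_le_of_norm_hasFDerivWithin_le (x := e) (y := z)
    (C := ε * ‖z - e‖) (s := Metric.closedBall e ‖z - e‖)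
    (fun w _ => (hd w).hasFDerivWithinAt) (fun w hw => ?_) (convex_closedBall _ _)
    (Metric.mem_closedBall_self (norm_nonneg _)) (by simp [dist_eq_norm])
  · simpa [mul_assoc, sq] using hmv
  · rw [Metric.mem_closedBall, dist_eq_norm] at hw
    have := hball (y := w) (by rw [dist_eq_norm] at hz ⊢; exact hw.trans_lt hz)
    have h3 : ‖(2 : ℕ) • innerSL ℝ (∇ V w - ∇ V e - H (w - e))‖ ≤
        2 * ‖∇ V w - ∇ V e - H (w - e)‖ := by
      rw [two_smul, two_mul]
      refine (norm_add_le _ _).trans (le_of_eq ?_)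
      simp only [innerSL_apply_norm]
    refine h3.trans ?_
    have h4 : ε / 2 * ‖w - e‖ ≤ ε / 2 * ‖z - e‖ := by gcongr
    linarith

theorem hessian_eigenvalue_ne_zero (he : IsNondegenerateCriticalPoint V e) {μ : ℝ} {b : Rd d}
    (hb : b ≠ 0) (h : fderiv ℝ (∇ V) e b = μ • b) : μ ≠ 0 := by
  rintro rfl
  have hu := (spectrum.zero_notMem_iff ℝ).1 he.zero_notMem_spectrum
  have hinj := (ContinuousLinearMap.isUnit_iff_bijective.1 hu).injective
  exact hb (hinj (by rw [h, zero_smul, map_zero]))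

theorem fderiv_vectorField_apply (hV : ContDiff ℝ 2 V) (c : ℝ) (x y : Rd d) :
    fderiv ℝ (vectorField c V) (e, 0) (x, y) = (y, fderiv ℝ (∇ V) e x - c • y) := by
  have h1 : HasFDerivAt (fun U : Rd d × Rd d => ∇ V U.1)
      ((fderiv ℝ (∇ V) e).comp (ContinuousLinearMap.fst ℝ (Rd d) (Rd d))) (e, 0) :=
    HasFDerivAt.comp (f := Prod.fst) (e, (0 : Rd d)) (hasFDerivAt_gradient hV e) hasFDerivAt_fst
  have h : HasFDerivAt (vectorField c V) _ (e, 0) :=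
    hasFDerivAt_snd.prodMk (h1.fun_sub ((hasFDerivAt_snd (p := (e, (0 : Rd d)))).const_smul c))
  rw [h.fderiv]
  simp

end Hessian

/-! ### Vectors of spectral subspaces -/

section Spectral

variable {F : Type*} [AddCommGroup F] [Module ℝ F] {A : F →ₗ[ℝ] F} {Λ : Set ℂ} {x : F}

theorem mem_spectralSubspace_of_apply_eq_smul {l : ℝ} (h : A x = l • x) (hl : (l : ℂ) ∈ Λ) :
    x ∈ spectralSubspace A Λ := by
  change (1 : ℂ) ⊗ₜ[ℝ] x ∈ ⨆ l ∈ Λ, Module.End.maxGenEigenspace (A.baseChange ℂ) l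
  refine Submodule.mem_iSup_of_mem (l : ℂ) (Submodule.mem_iSup_of_mem hl ?_)
  rw [Module.End.mem_maxGenEigenspace]
  refine ⟨1, ?_⟩
  rw [pow_one, LinearMap.sub_apply, LinearMap.baseChange_tmul, h, LinearMap.smul_apply,
    Module.End.one_apply, TensorProduct.tmul_smul, sub_eq_zero]
  exact RCLike.real_smul_eq_coe_smul (K := ℂ) l _

/-- A vector killed by a product of two linear factors is a sum of generalized eigenvectors. -/
theorem mem_iSup_maxGenEigenspace {E : Type*} [AddCommGroup E] [Module ℂ E] {B : Module.End ℂ E}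
    {z : E} {l m : ℂ} (hl : l ∈ Λ) (hm : m ∈ Λ) (h : (B - l • 1) ((B - m • 1) z) = 0) :
    z ∈ ⨆ l ∈ Λ, Module.End.maxGenEigenspace B l := by
  have hmem : ∀ n ∈ Λ, ∀ w (k : ℕ), ((B - n • 1) ^ k) w = 0 →
      w ∈ ⨆ l ∈ Λ, Module.End.maxGenEigenspace B l := fun n hn w k hw =>
    Submodule.mem_iSup_of_mem n (Submodule.mem_iSup_of_mem hn
      ((Module.End.mem_maxGenEigenspace _ _ _).2 ⟨k, hw⟩))
  by_cases hlm : l = m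
  · subst hlm
    exact hmem l hl z 2 (by rw [pow_two, Module.End.mul_apply, h])
  · have e1 := hmem l hl ((B - m • 1) z) 1 (by rw [pow_one, h])
    have e2 := hmem m hm ((B - l • 1) z) 1 (by
      rw [pow_one, ← h]; simp [smul_sub, smul_comm l m]; abel)
    have e3 : z = (l - m)⁻¹ • ((B - m • 1) z - (B - l • 1) z) := by
      rw [eq_inv_smul_iff₀ (sub_ne_zero.2 hlm)]
      simp [sub_smul]
    rw [e3]
    exact Submodule.smul_mem _ _ (Submodule.sub_mem _ e1 e2)

/-- If `A² + c A - μ` kills `x` and all its complex roots lie in `Λ`, then `x` belongs to the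
spectral subspace of `Λ`; the roots may be complex or coincide. -/
theorem mem_spectralSubspace_of_quadratic {c μ : ℝ} (h : A (A x) + c • A x = μ • x)
    (hΛ : ∀ l : ℂ, l ^ 2 + c * l = μ → l ∈ Λ) : x ∈ spectralSubspace A Λ := by
  obtain ⟨w, hw⟩ := IsAlgClosed.exists_pow_nat_eq ((c : ℂ) ^ 2 + 4 * μ) two_pos
  change (1 : ℂ) ⊗ₜ[ℝ] x ∈ ⨆ l ∈ Λ, Module.End.maxGenEigenspace (A.baseChange ℂ) l
  refine mem_iSup_maxGenEigenspace (l := (-c + w) / 2) (m := (-c - w) / 2)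
    (hΛ _ (by linear_combination hw / 4)) (hΛ _ (by linear_combination hw / 4)) ?_
  have h' := congrArg (fun y => (1 : ℂ) ⊗ₜ[ℝ] y) h
  have hr : ∀ (r : ℝ) (z : ℂ ⊗[ℝ] F), r • z = (r : ℂ) • z := fun r z =>
    RCLike.real_smul_eq_coe_smul (K := ℂ) r z
  simp only [TensorProduct.tmul_add, TensorProduct.tmul_smul, hr] at h'
  simp only [LinearMap.sub_apply, LinearMap.smul_apply, Module.End.one_apply, map_sub, map_smul,
    LinearMap.baseChange_tmul]
  rw [← sub_eq_zero] at h'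
  rw [← h']
  have hμ : (μ : ℂ) = -((-c + w) / 2 * ((-c - w) / 2)) := by linear_combination -hw / 4
  rw [hμ]
  module

/-- If `μ < 0` and `c ≠ 0`, both roots of `X² + c X - μ` have a real part of the sign of `-c`. -/
theorem re_of_quadratic {c μ : ℝ} (hμ : μ < 0) {l : ℂ} (h : l ^ 2 + c * l = μ) :
    c * l.re < 0 ∨ c = 0 := by
  by_cases hc : c = 0
  · exact .inr hc
  left
  have h1 := congrArg Complex.re h
  have h2 := congrArg Complex.im h
  simp [pow_two] at h1 h2
  have h3 : l.im * (2 * l.re + c) = 0 := by linarith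
  rcases mul_eq_zero.1 h3 with h4 | h4
  · rw [h4] at h1
    nlinarith [sq_nonneg l.re]
  · have : l.re = -c / 2 := by linarith
    rw [this]
    have : 0 < c ^ 2 := by positivity
    linarith

end Spectral

/-! ### Solutions that converge to a non-degenerate critical point -/

theorem OrthonormalBasis.norm_sub_sum_sq {ι F : Type*} [Fintype ι] [NormedAddCommGroup F]
    [InnerProductSpace ℝ F] (b : OrthonormalBasis ι ℝ F) (w : F) (a : ι → ℝ) :
    ‖w - ∑ i, a i • b i‖ ^ 2 = ∑ i, (inner ℝ (b i) w - a i) ^ 2 := by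
  rw [← b.sum_sq_norm_inner_right]
  refine Finset.sum_congr rfl fun i _ => ?_
  rw [inner_sub_right, b.orthonormal.inner_right_fintype, Real.norm_eq_abs, sq_abs]

/-- The energy `‖u'‖² / 2 - V(u)` of a standing wave is conserved, hence equal to its limit. -/
theorem norm_velocity_sq_eq {d : ℕ} {V : Rd d → ℝ} (hV : ContDiff ℝ 2 V) {e : Rd d}
    {u v : ℝ → Rd d} (hu : ∀ t, HasDerivAt u (v t) t) (hv : ∀ t, HasDerivAt v (∇ V (u t)) t)
    (hlim : Tendsto u atTop (𝓝 e)) (hlimv : Tendsto v atTop (𝓝 0)) (t : ℝ) :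
    ‖v t‖ ^ 2 = 2 * (V (u t) - V e) := by
  have hd : ∀ t, HasDerivAt (fun t => ‖v t‖ ^ 2 - 2 * V (u t)) 0 t := fun t =>
    ((hv t).norm_sq.fun_sub
      (((hasFDerivAt_potential hV (u t)).comp_hasDerivAt t (hu t)).const_mul 2)).congr_deriv (by
        simp)
  have hconst := is_const_of_deriv_eq_zero (fun t => (hd t).differentiableAt) fun t => (hd t).deriv
  have h1 : Tendsto (fun t => ‖v t‖ ^ 2 - 2 * V (u t)) atTop (𝓝 (‖(0 : Rd d)‖ ^ 2 - 2 * V e)) :=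
    (hlimv.norm.pow 2).sub (((hV.continuous.tendsto e).comp hlim).const_mul 2)
  have h2 : (fun t => ‖v t‖ ^ 2 - 2 * V (u t)) = fun _ => ‖v t‖ ^ 2 - 2 * V (u t) :=
    funext fun s => hconst s t
  rw [h2] at h1
  have := tendsto_nhds_unique h1 tendsto_const_nhds
  simp at this
  linarith

/-- A solution that converges to a non-degenerate critical point at `+∞` does so exponentially fast
and tangentially to any subspace `M` that contains the stable directions, written in terms of
eigenvectors of the Hessian. -/
theorem decay_of_tendsto {d : ℕ} {V : Rd d → ℝ} (hV : ContDiff ℝ 2 V) {e : Rd d}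
    (he : IsNondegenerateCriticalPoint V e) {c : ℝ} {u v : ℝ → Rd d}
    (hu : ∀ t, HasDerivAt u (v t) t) (hv : ∀ t, HasDerivAt v (-(c • v t) + ∇ V (u t)) t)
    (hlim : Tendsto u atTop (𝓝 e)) (M : Submodule ℝ (Rd d × Rd d))
    (hM : ∀ (b : Rd d) (μ : ℝ), μ ≠ 0 → fderiv ℝ (∇ V) e b = μ • b → ∀ x y,
      ((stableProj c μ x y).1 • b, (stableProj c μ x y).2 • b) ∈ M) :
    Tendsto v atTop (𝓝 0) ∧
      (∃ β : ℝ, 0 < β ∧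
        (fun ξ => (u ξ, v ξ) - (e, 0)) =O[atTop] fun ξ => Real.exp (-(β * ξ))) ∧
      (fun ξ => Metric.infDist ((u ξ, v ξ) - (e, 0)) (M : Set (Rd d × Rd d)))
        =o[atTop] fun ξ => (u ξ, v ξ) - (e, 0) := by
  have hlimG : Tendsto (fun t => ∇ V (u t)) atTop (𝓝 0) := by
    simpa [he.gradient_eq_zero, Function.comp_def] using
      ((contDiff_gradient hV).continuous.tendsto e).comp hlim
  have hlimv := tendsto_velocity_zero hu hv hlim hlimG
  refine ⟨hlimv, ?_⟩
  set H := fderiv ℝ (∇ V) e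
  have hsymm : H.toLinearMap.IsSymmetric := isSymmetric_hessian hV
  have hfin : Module.finrank ℝ (Rd d) = d := finrank_euclideanSpace_fin
  set b := hsymm.eigenvectorBasis hfin
  set μ := hsymm.eigenvalues hfin
  have hb : ∀ i, H (b i) = μ i • b i := fun i => hsymm.apply_eigenvectorBasis hfin i
  have hμ : ∀ i, μ i ≠ 0 := fun i =>
    hessian_eigenvalue_ne_zero he (norm_ne_zero_iff.1 (by rw [b.norm_eq_one]; exact one_ne_zero))
      (hb i)
  have hbH : ∀ i w, inner ℝ (b i) (H w) = μ i * inner ℝ (b i) w := fun i w => by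
    have := hsymm (b i) w
    change inner ℝ (H (b i)) w = inner ℝ (b i) (H w) at this
    rw [← this, hb, real_inner_smul_left]
  have hsq : ∀ w, ∑ i, inner ℝ (b i) w ^ 2 = ‖w‖ ^ 2 := fun w => by
    simpa using b.sum_sq_norm_inner_right w
  have hHw : ∀ w, ∑ i, μ i * inner ℝ (b i) w ^ 2 = inner ℝ w (H w) := fun w => by
    rw [← b.sum_inner_mul_inner]
    refine Finset.sum_congr rfl fun i _ => ?_
    rw [hbH, real_inner_comm]; ring
  set N : ℝ → ℝ := fun t => ‖u t - e‖ ^ 2 + ‖v t‖ ^ 2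
  have hlimw : Tendsto (fun t => u t - e) atTop (𝓝 0) := by simpa using hlim.sub_const e
  obtain ⟨⟨β, hβ, K, hK⟩, hD⟩ := decay_of_coordinates (c := c) hμ
    (x := fun i t => inner ℝ (b i) (u t - e)) (y := fun i t => inner ℝ (b i) (v t))
    (g := fun i t => inner ℝ (b i) (∇ V (u t) - H (u t - e))) (N := N)
    (fun t => by rw [Finset.sum_add_distrib, hsq, hsq])
    (fun i t => by simpa using (hasDerivAt_const t (b i)).inner ℝ ((hu t).sub_const e))
    (fun i t => by
      refine ((hasDerivAt_const t (b i)).inner ℝ (hv t)).congr_deriv ?_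
      rw [inner_zero_left, add_zero, inner_sub_right (b i) (∇ V (u t)), hbH, inner_add_right,
        inner_neg_right, real_inner_smul_right]
      ring)
    (fun ε hε => by
      have hlo := (hasFDerivAt_gradient hV e).isLittleO.def hε
      filter_upwards [hlim.eventually hlo] with t ht i
      rw [he.gradient_eq_zero, sub_zero] at ht
      refine (abs_real_inner_le_norm _ _).trans ?_
      rw [b.norm_eq_one, one_mul]
      refine ht.trans (mul_le_mul_of_nonneg_left ?_ hε.le)
      exact Real.le_sqrt_of_sq_le (le_add_of_nonneg_right (sq_nonneg _)))
    (by simpa using (hlimw.norm.pow 2).add (hlimv.norm.pow 2))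
    (fun hc ε hε => by
      filter_upwards [hlim.eventually (eventually_taylor_potential hV he.gradient_eq_zero hε)]
        with t ht
      rw [Finset.sum_sub_distrib, hsq, hHw, norm_velocity_sq_eq hV hu
        (fun t => by simpa [hc] using hv t) hlim hlimv]
      refine (le_abs_self _).trans (ht.trans (mul_le_mul_of_nonneg_left ?_ hε.le))
      exact le_add_of_nonneg_right (sq_nonneg _))
  have hnormsq : ∀ w z : Rd d, ‖(w, z)‖ ^ 2 ≤ ‖w‖ ^ 2 + ‖z‖ ^ 2 := fun w z => by
    rw [Prod.norm_mk]
    rcases max_cases ‖w‖ ‖z‖ with h | h <;> rw [h.1] <;> nlinarith [sq_nonneg ‖w‖, sq_nonneg ‖z‖]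
  have hUE : ∀ t, (u t, v t) - (e, 0) = (u t - e, v t) := fun t => by simp
  simp only [hUE]
  constructor
  · refine ⟨β / 2, by positivity, IsBigO.of_bound (√|K|) ?_⟩
    filter_upwards [hK] with t ht
    rw [Real.norm_eq_abs, abs_of_pos (Real.exp_pos _)]
    refine abs_le_of_sq_le_sq' ?_ (by positivity) |>.2
    rw [mul_pow, Real.sq_sqrt (abs_nonneg _), ← Real.exp_nat_mul]
    refine (hnormsq _ _).trans (ht.trans ?_)
    rw [show ((2 : ℕ) : ℝ) * -(β / 2 * t) = -(β * t) by push_cast; ring]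
    gcongr
    exact le_abs_self K
  · refine IsLittleO.of_bound fun ε hε => ?_
    filter_upwards [hD (ε ^ 2 / 2) (by positivity)] with t ht
    rw [Real.norm_eq_abs, abs_of_nonneg Metric.infDist_nonneg]
    set p : Fin d → ℝ × ℝ := fun i =>
      stableProj c (μ i) (inner ℝ (b i) (u t - e)) (inner ℝ (b i) (v t))
    set m : Rd d × Rd d := ∑ i, ((p i).1 • b i, (p i).2 • b i) with hm
    have hmM : m ∈ M := Submodule.sum_mem _ fun i _ => hM (b i) (μ i) (hμ i) (hb i) _ _
    refine (Metric.infDist_le_dist_of_mem hmM).trans ?_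
    refine abs_le_of_sq_le_sq' ?_ (by positivity) |>.2
    have hsub : (u t - e, v t) - m =
        ((u t - e) - ∑ i, (p i).1 • b i, v t - ∑ i, (p i).2 • b i) := by
      rw [hm]
      ext1
      · simp [Prod.fst_sum]
      · simp [Prod.snd_sum]
    rw [dist_eq_norm, hsub]
    refine (hnormsq _ _).trans ?_
    rw [b.norm_sub_sum_sq, b.norm_sub_sum_sq, ← Finset.sum_add_distrib]
    refine ht.trans ?_
    have e1 : ‖u t - e‖ ≤ ‖(u t - e, v t)‖ := le_max_left _ _
    have e2 : ‖v t‖ ≤ ‖(u t - e, v t)‖ := le_max_right _ _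
    have e3 : N t ≤ 2 * ‖(u t - e, v t)‖ ^ 2 := by
      rw [two_mul]; exact add_le_add (by gcongr) (by gcongr)
    calc ε ^ 2 / 2 * N t ≤ ε ^ 2 / 2 * (2 * ‖(u t - e, v t)‖ ^ 2) := by gcongr
      _ = _ := by ring

/-! ### Stable and unstable directions -/

section Directions

variable {d : ℕ} {V : Rd d → ℝ} {e b : Rd d} {μ : ℝ}

/-- If `μ < 0` and `c ≠ 0`, the whole plane spanned by `(b, 0)` and `(0, b)` is stable or unstable,
according to the sign of `c`. -/
theorem smul_prod_mem_spectralSubspace (hV : ContDiff ℝ 2 V) {c : ℝ} (hμ : μ < 0)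
    (hb : fderiv ℝ (∇ V) e b = μ • b) {Λ : Set ℂ} (hΛ : ∀ l : ℂ, c * l.re < 0 → l ∈ Λ)
    (hc : c ≠ 0) (x y : ℝ) :
    (x • b, y • b) ∈ spectralSubspace (fderiv ℝ (vectorField c V) (e, 0)).toLinearMap Λ := by
  refine mem_spectralSubspace_of_quadratic (c := c) (μ := μ) ?_ fun l hl =>
    hΛ l ((re_of_quadratic hμ hl).resolve_right hc)
  simp only [ContinuousLinearMap.coe_coe, fderiv_vectorField_apply hV, map_smul, hb]
  ext1
  · simp [smul_comm x μ]
  · simp; module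

theorem stableProj_mem_stableSubspace (hV : ContDiff ℝ 2 V) {c : ℝ} (hμ : μ ≠ 0)
    (hb : fderiv ℝ (∇ V) e b = μ • b) (x y : ℝ) :
    ((stableProj c μ x y).1 • b, (stableProj c μ x y).2 • b) ∈ stableSubspace c V (e, 0) := by
  unfold stableProj
  split_ifs with h1 h2
  · refine mem_spectralSubspace_of_apply_eq_smul (l := rootMinus c μ) ?_ ?_
    · have hq := rootMinus_sq (c := c) h1
      simp only [ContinuousLinearMap.coe_coe, fderiv_vectorField_apply hV, map_smul, hb]
      ext1
      · simp [smul_smul]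
      · simp only [Prod.smul_mk, smul_smul, ← sub_smul]
        congr 1
        linear_combination -x * hq
    · simpa using rootMinus_neg h1
  · exact smul_prod_mem_spectralSubspace hV (hμ.lt_of_le (not_lt.1 h1)) hb
      (fun l hl => by
        change l.re < 0; nlinarith) h2.ne' x y
  · simp only [zero_smul]; exact Submodule.zero_mem _

/-- Reversing the time turns the stable directions for `-c` into unstable directions for `c`. -/
theorem stableProj_mem_unstableSubspace (hV : ContDiff ℝ 2 V) {c : ℝ} (hμ : μ ≠ 0)
    (hb : fderiv ℝ (∇ V) e b = μ • b) (x y : ℝ) :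
    ((stableProj (-c) μ x y).1 • b, -((stableProj (-c) μ x y).2 • b)) ∈
      unstableSubspace c V (e, 0) := by
  unfold stableProj
  split_ifs with h1 h2
  · refine mem_spectralSubspace_of_apply_eq_smul (l := -rootMinus (-c) μ) ?_ ?_
    · have hq := rootMinus_sq (c := -c) h1
      simp only [ContinuousLinearMap.coe_coe, ← neg_smul, fderiv_vectorField_apply hV, map_smul, hb]
      ext1
      · simp [smul_smul]
      · simp only [Prod.smul_mk, smul_smul, ← sub_smul]
        congr 1
        linear_combination -x * hq
    · simpa using rootMinus_neg h1
  · rw [← neg_smul]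
    exact smul_prod_mem_spectralSubspace hV (hμ.lt_of_le (not_lt.1 h1)) hb
      (fun l hl => by
        change 0 < l.re; nlinarith) (by linarith [h2] : c < 0).ne x (-y)
  · simp only [zero_smul, neg_zero]; exact Submodule.zero_mem _

end Directions

theorem convergesThroughStable_of_tendsto {d : ℕ} {V : Rd d → ℝ} (hV : ContDiff ℝ 2 V) {e : Rd d}
    (he : IsNondegenerateCriticalPoint V e) {c : ℝ} {u v : ℝ → Rd d}
    (hu : ∀ t, HasDerivAt u (v t) t) (hv : ∀ t, HasDerivAt v (-(c • v t) + ∇ V (u t)) t)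
    (hlim : Tendsto u atTop (𝓝 e)) :
    Tendsto v atTop (𝓝 0) ∧ ConvergesThroughStable c V (e, 0) fun ξ => (u ξ, v ξ) :=
  decay_of_tendsto hV he hu hv hlim _ fun _ _ hμ hb => stableProj_mem_stableSubspace hV hμ hb

theorem convergesThroughUnstable_of_tendsto {d : ℕ} {V : Rd d → ℝ} (hV : ContDiff ℝ 2 V)
    {e : Rd d} (he : IsNondegenerateCriticalPoint V e) {c : ℝ} {u v : ℝ → Rd d}
    (hu : ∀ t, HasDerivAt u (v t) t) (hv : ∀ t, HasDerivAt v (-(c • v t) + ∇ V (u t)) t)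
    (hlim : Tendsto u atBot (𝓝 e)) :
    Tendsto v atBot (𝓝 0) ∧ ConvergesThroughUnstable c V (e, 0) fun ξ => (u ξ, v ξ) := by
  set R : (Rd d × Rd d) →ₗ[ℝ] (Rd d × Rd d) := LinearMap.prodMap LinearMap.id (-LinearMap.id)
  have hRa : ∀ w z, R (w, z) = (w, -z) := fun w z => rfl
  have hRiso : Isometry R := Isometry.of_dist_eq fun p q => by
    rw [dist_eq_norm, dist_eq_norm, ← map_sub]
    obtain ⟨w, z⟩ := p - q
    rw [hRa, Prod.norm_mk, Prod.norm_mk, norm_neg]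
  obtain ⟨h1, ⟨β, hβ, h2⟩, h3⟩ := decay_of_tendsto (c := -c) (u := fun ξ => u (-ξ))
    (v := fun ξ => -v (-ξ)) hV he
    (fun t => by simpa using (hu (-t)).comp_neg_at)
    (fun t => by simpa using (hv (-t)).comp_neg_at.fun_neg)
    (hlim.comp tendsto_neg_atTop_atBot) ((unstableSubspace c V (e, 0)).map R)
    (fun b μ hμ hb x y =>
      ⟨_, stableProj_mem_unstableSubspace hV hμ hb x y, by rw [hRa, neg_neg]⟩)
  have hUR : ∀ ξ, (u (-ξ), -v (-ξ)) - (e, 0) = R ((u (-ξ), v (-ξ)) - (e, 0)) := fun ξ => by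
    simp [hRa]
  have hnorm : ∀ p, ‖R p‖ = ‖p‖ := fun p => by
    simpa [dist_eq_norm] using hRiso.dist_eq p 0
  have hinf : ∀ ξ, Metric.infDist ((u (-ξ), -v (-ξ)) - (e, 0))
      ((unstableSubspace c V (e, 0)).map R : Set (Rd d × Rd d)) =
      Metric.infDist ((u (-ξ), v (-ξ)) - (e, 0)) (unstableSubspace c V (e, 0)) := fun ξ => by
    rw [hUR, Submodule.map_coe, Metric.infDist_image hRiso]
  have hn : ∀ ξ, ‖(u (-ξ), -v (-ξ)) - (e, 0)‖ = ‖(u (-ξ), v (-ξ)) - (e, 0)‖ := fun ξ => by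
    rw [hUR, hnorm]
  have h2' : (fun ξ => (u (-ξ), v (-ξ)) - (e, 0)) =O[atTop] _ :=
    (h2.norm_left.congr_left hn).of_norm_left
  have h3' : _ =o[atTop] (fun ξ => (u (-ξ), v (-ξ)) - (e, 0)) :=
    ((h3.norm_right.congr_left hinf).congr_right hn).of_norm_right
  refine ⟨by simpa [Function.comp_def] using (h1.comp tendsto_neg_atBot_atTop).neg,
    ⟨β, hβ, ?_⟩, ?_⟩
  · simpa [Function.comp_def] using h2'.comp_tendsto tendsto_neg_atBot_atTop
  · simpa [Function.comp_def] using h3'.comp_tendsto tendsto_neg_atBot_atTop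

/-! ### Profiles of fronts and pulses -/

theorem proposition1p2 (d : ℕ) (V : Rd d → ℝ) (hV : ContDiff ℝ 2 V) (em ep : Rd d)
    (hem : IsNondegenerateCriticalPoint V em) (hep : IsNondegenerateCriticalPoint V ep)
    (c : ℝ) (u : ℝ → Rd d) (hu : IsFrontOrPulse c V em ep u) :
    Set.range (fun ξ : ℝ => (u ξ, deriv u ξ)) ⊆
        unstableManifold c V (em, 0) ∩ stableManifold c V (ep, 0) ∧
      Tendsto (deriv u) atBot (𝓝 0) ∧ Tendsto (deriv u) atTop (𝓝 0) ∧
      ConvergesThroughUnstable c V (em, 0) (fun ξ : ℝ => (u ξ, deriv u ξ)) ∧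
      ConvergesThroughStable c V (ep, 0) (fun ξ : ℝ => (u ξ, deriv u ξ)) := by
  have h : ConnectsProfile c V em ep u := by
    rcases hu with h | h | h <;> exact h.1
  have h1 : ∀ t, HasDerivAt u (deriv u t) t := fun t => (h.isWaveProfile.1 t).hasDerivAt
  have h2 := h.isWaveProfile.2
  obtain ⟨hv, hs⟩ := convergesThroughStable_of_tendsto hV hep h1 h2 h.tendsto_atTop
  obtain ⟨hv', hs'⟩ := convergesThroughUnstable_of_tendsto hV hem h1 h2 h.tendsto_atBot
  have hU : ∀ ξ, HasDerivAt (fun ξ : ℝ => (u ξ, deriv u ξ)) (vectorField c V (u ξ, deriv u ξ)) ξ :=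
    fun ξ => by
      have := (h1 ξ).prodMk (h2 ξ)
      rwa [neg_add_eq_sub] at this
  refine ⟨?_, hv', hv, hs', hs⟩
  rintro _ ⟨ξ, rfl⟩
  exact ⟨⟨_, ξ + 1, fun t _ => hU t, hs', ξ, by simp, rfl⟩,
    ⟨_, ξ - 1, fun t _ => hU t, hs, ξ, by simp, rfl⟩⟩
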